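/- For real numbers $0<\lambda_1<\lambda_n$ put $\kappa=\lambda_n/\lambda_1$, $c=(\lambda_n+\lambda_1)/2$, $r=(\lambda_n-\lambda_1)/2$ and, for real $t\notin[\lambda_1,\lambda_n]$ and $s=(t-c)/r$, $$\Phi(t)=\begin{cases} s+\sqrt{s^2-1}, & t>\lambda_n,\\ \bigl(s+\sqrt{s^2-1}\bigr)^{-1}, & t<\lambda_1,\end{cases}$$ so that $|\Phi(t)|>1$ and $\Phi$ is the inverse of $w\mapsto c+\frac r2\bigl(w+\frac1w\bigr)$. Put $$B(w)=w\,\frac{1-\Phi(0)w}{\Phi(0)-w},\qquad E(\sigma)=B\bigl(\Phi(-\sigma)^{-1}\bigr)\quad\text{for }\sigma\in\mathbb R\setminus[-\lambda_n,-\lambda_1].$$ For an invertible $A\in\mathbb R^{n\times n}$ and $b\in\mathbb R^n$ let the extended Krylov subspace $\mathcal K_j(A,b)$ be the span of the first $j$ of the vectors $b, A^{-1}b, Ab, A^{-2}b, A^2b,\dots$ Theorem. Let $0<\lambda_1<\lambda_n$ and $\delta_1,\delta_n>0$, and let $$\mu=\max\left(\sqrt{|E(-\lambda_n-\delta_n)|},\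 \sqrt{|E(-\lambda_1+\delta_1)|},\ \frac{\kappa^{1/4}-1}{\kappa^{1/4}+1}\right).$$ Then $\mu<1$, and there is a constant $C$, depending only on $\lambda_1,\lambda_n,\delta_1,\delta_n$, such that the following holds for every $n$, every symmetric positive definite $A\in\mathbb R^{n\times n}$ with smallest eigenvalue $\lambda_1$ and largest eigenvalue $\lambda_n$, and every $b\in\mathbb R^n$: for all real $\sigma\notin(-\lambda_n-\delta_n,-\lambda_1+\delta_1)$ the matrix $A+\sigma I$ is invertible, and with $x(\sigma)=(A+\sigma I)^{-1}b$, for every $j\ge 0$ there is an element $x_j\in\mathcal K_j(A,b)$ with $$\|x_j-x(\sigma)\|_2\le C\,\|b\|_2\,\mu^{j}.$$ That is, the extended Krylov method approximates the whole solution manifold $\{x(\sigma)\}$ at worst linearly, with rate $\mu$ uniformly in $\sigma$. -/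

import Mathlib

/-- The exterior (Joukowski) map of the interval `[l, L]`, on real arguments:
`t ↦ c + (r / 2) (t + 1 / t)` with `c = (L + l) / 2` and `r = (L - l) / 2`. -/
noncomputable def joukowskiPsi (l L t : ℝ) : ℝ :=
  (L + l) / 2 + (L - l) / 2 / 2 * (t + 1 / t)

/-- The inverse of the exterior map, on real arguments outside `[l, L]` (values in between are
irrelevant).  With `s = (t - c) / r` it is `s + √(s² - 1)` to the right of the interval, and the
reciprocal of that expression, which is `s - √(s² - 1)`, to the left of it.  The two facts
following this definition say that it is the inverse with values outside the unit disk. -/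
noncomputable def joukowskiPhi (l L t : ℝ) : ℝ :=
  let s : ℝ := (t - (L + l) / 2) / ((L - l) / 2)
  if L ≤ t then s + √(s ^ 2 - 1) else (s + √(s ^ 2 - 1))⁻¹

theorem one_lt_abs_joukowskiPhi {l L t : ℝ} (h : l < L) (ht : t ∉ Set.Icc l L) :
    1 < |joukowskiPhi l L t| := by
  have hr : 0 < (L - l) / 2 := by linarith
  unfold joukowskiPhi
  dsimp only
  set s : ℝ := (t - (L + l) / 2) / ((L - l) / 2) with hs
  split_ifs with h1
  · have h2 : L < t := by
      rcases h1.lt_or_eq with h2 | h2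
      · exact h2
      · exact absurd ⟨by linarith, h2.ge⟩ ht
    have : 1 < s := by rw [hs, lt_div_iff₀ hr]; linarith
    have h3 := Real.sqrt_nonneg (s ^ 2 - 1)
    rw [abs_of_pos (by linarith)]; linarith
  · have h2 : t < l := by
      by_contra h2
      exact ht ⟨not_lt.mp h2, (not_le.mp h1).le⟩
    have hs1 : s < -1 := by rw [hs, div_lt_iff₀ hr]; linarith
    have hq : 0 < s ^ 2 - 1 := by nlinarith
    have h3 := Real.sqrt_pos.mpr hq
    have h4 := Real.sq_sqrt hq.le
    have h5 : s + √(s ^ 2 - 1) < 0 := by nlinarith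
    have h6 : -1 < s + √(s ^ 2 - 1) := by nlinarith
    rw [abs_inv, abs_of_neg h5]
    exact (one_lt_inv₀ (by linarith)).mpr (by linarith)

theorem joukowskiPsi_joukowskiPhi {l L t : ℝ} (h : l < L) (ht : t ∉ Set.Icc l L) :
    joukowskiPsi l L (joukowskiPhi l L t) = t := by
  have hr : 0 < (L - l) / 2 := by linarith
  set s : ℝ := (t - (L + l) / 2) / ((L - l) / 2) with hs
  have hst : t = (L + l) / 2 + (L - l) / 2 * s := by
    rw [hs, mul_div_cancel₀ _ hr.ne']; ring
  have hq : 0 ≤ s ^ 2 - 1 := by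
    by_cases h1 : L ≤ t
    · have : 1 ≤ s := by rw [hs, le_div_iff₀ hr]; linarith
      nlinarith
    · have h2 : t < l := by
        by_contra h2
        exact ht ⟨not_lt.mp h2, (not_le.mp h1).le⟩
      have : s < -1 := by rw [hs, div_lt_iff₀ hr]; linarith
      nlinarith
  have h4 := Real.sq_sqrt hq
  have h0 : (s + √(s ^ 2 - 1)) * (s - √(s ^ 2 - 1)) = 1 := by nlinarith
  have hinv : (s + √(s ^ 2 - 1))⁻¹ = s - √(s ^ 2 - 1) := inv_eq_of_mul_eq_one_right h0
  have key : (s + √(s ^ 2 - 1)) + (s + √(s ^ 2 - 1))⁻¹ = 2 * s := by rw [hinv]; ring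
  unfold joukowskiPsi joukowskiPhi
  dsimp only
  rw [← hs]
  split_ifs
  · rw [one_div, key]; linarith
  · rw [one_div, inv_inv, add_comm _ (s + √(s ^ 2 - 1)), key]; linarith

/-- The Blaschke product `w (1 - conj (Φ 0) w) / (Φ 0 - w)` on real arguments (`Φ 0` is real). -/
noncomputable def blaschkeB (l L w : ℝ) : ℝ :=
  w * ((1 - joukowskiPhi l L 0 * w) / (joukowskiPhi l L 0 - w))

/-- `E(σ) = B (Φ (-σ)⁻¹)`, for `σ` outside `[-L, -l]`. -/
noncomputable def rateE (l L σ : ℝ) : ℝ :=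
  blaschkeB l L (joukowskiPhi l L (-σ))⁻¹

/-- The rate
`max (√|E(-L - δn)|, √|E(-l + δ1)|, (κ^(1/4) - 1) / (κ^(1/4) + 1))` with `κ = L / l`. -/
noncomputable def manifoldRate (l L δ1 δn : ℝ) : ℝ :=
  max (max (√|rateE l L (-L - δn)|) (√|rateE l L (-l + δ1)|))
    (((L / l) ^ (1 / 4 : ℝ) - 1) / ((L / l) ^ (1 / 4 : ℝ) + 1))

/-- The vectors `b, A⁻¹ b, A b, A⁻² b, A² b, …`, indexed from `0`. -/
noncomputable def extKrylovVec {n : ℕ} (A : Matrix (Fin n) (Fin n) ℝ)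
    (b : EuclideanSpace ℝ (Fin n)) (i : ℕ) : EuclideanSpace ℝ (Fin n) :=
  if Even i then WithLp.toLp 2 ((A ^ (i / 2)).mulVec b.ofLp)
  else WithLp.toLp 2 ((A⁻¹ ^ ((i + 1) / 2)).mulVec b.ofLp)

/-- The extended Krylov subspace `K_j(A, b)`: the span of the first `j` of the vectors
`b, A⁻¹ b, A b, A⁻² b, A² b, …`. -/
noncomputable def extKrylov {n : ℕ} (A : Matrix (Fin n) (Fin n) ℝ)
    (b : EuclideanSpace ℝ (Fin n)) (j : ℕ) : Submodule ℝ (EuclideanSpace ℝ (Fin n)) :=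
  Submodule.span ℝ (extKrylovVec A b '' {i | i < j})

/-- `x(σ) = (A + σ I)⁻¹ b`. -/
noncomputable def shiftedSolution {n : ℕ} (A : Matrix (Fin n) (Fin n) ℝ)
    (b : EuclideanSpace ℝ (Fin n)) (σ : ℝ) : EuclideanSpace ℝ (Fin n) :=
  WithLp.toLp 2 ((A + σ • (1 : Matrix (Fin n) (Fin n) ℝ))⁻¹.mulVec b.ofLp)

/-! Write the interval as `[a², b²]`, which makes `Φ(0)` rational in `a` and `b`. The Laurent
polynomial `y = laurentMap a b` has powers `t⁻¹, 1, t` and maps the interval into `[-1, 1]`. Its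
link with the Blaschke product is `E + E⁻¹ = 2 y(-σ)` for `E = E(σ)` (`rateE_add_inv`). Hence `2
T_m(y(-σ)) = E^m + E^(-m)`, which is at least of size `|E|^(-m)`, while `|T_m(y(x))| ≤ 1` on the
spectrum.

The function `(x + σ)⁻¹ (1 - T_m(y(x)) / T_m(y(-σ)))` is therefore a Laurent polynomial with powers
from `-m` to `m - 1`, exactly those spanning `K_{2m}`. Applied to `b` it misses `x(σ)` by at most a
constant times `|E|^m ‖b‖`.

It remains to see `|E(σ)| ≤ μ²` for nonzero admissible `σ` (`abs_rateE_le_manifoldRate_sq`). Since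
`|E| + |E|⁻¹ = 2 |y(-σ)|` and `|E| < 1`, this amounts to minimizing `|y|`: monotonicity covers `-σ >
0`, AM-GM covers `-σ < 0`. -/

/-! ### The Laurent map and its relation to `E`. -/

theorem joukowskiPhi_zero {a b : ℝ} (ha : 0 < a) (hab : a < b) :
    joukowskiPhi (a ^ 2) (b ^ 2) 0 = -((b + a) / (b - a)) := by
  have h1 : 0 < b - a := sub_pos.mpr hab
  have h2 : 0 < b + a := by linarith
  have h3 : ¬ b ^ 2 ≤ 0 := by have : 0 < b := by linarith
                              exact not_le.mpr (by positivity)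
  have h4 : b ^ 2 - a ^ 2 = (b - a) * (b + a) := by ring
  have hs : ((0 - (b ^ 2 + a ^ 2) / 2) / ((b ^ 2 - a ^ 2) / 2)) ^ 2 - 1
      = (2 * a * b / ((b - a) * (b + a))) ^ 2 := by
    rw [h4]; field_simp; ring
  have hpos : 0 ≤ 2 * a * b / ((b - a) * (b + a)) := by
    have : 0 < b := by linarith
    positivity
  have hsum : (0 - (b ^ 2 + a ^ 2) / 2) / ((b ^ 2 - a ^ 2) / 2)
      + 2 * a * b / ((b - a) * (b + a)) = -((b - a) / (b + a)) := by
    rw [h4]; field_simp; ring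
  unfold joukowskiPhi
  dsimp only
  rw [if_neg h3, hs, Real.sqrt_sq hpos, hsum, inv_neg, inv_div]

/-- The degree-one Laurent polynomial mapping `[a², b²]` onto `[-1, 1]`, two-to-one, with
value `-1` at both ends. -/
noncomputable def laurentMap (a b t : ℝ) : ℝ :=
  1 - 2 * (t - a * b) ^ 2 / (t * (b - a) ^ 2)

theorem abs_laurentMap_le_one {a b t : ℝ} (ha : 0 < a) (hab : a < b)
    (ht : t ∈ Set.Icc (a ^ 2) (b ^ 2)) : |laurentMap a b t| ≤ 1 := by
  have ht0 : 0 < t := lt_of_lt_of_le (by positivity) ht.1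
  have h1 : 0 < b - a := sub_pos.mpr hab
  -- The difference of the two sides is `(t - a²)(b² - t)`.
  have h2 : (t - a * b) ^ 2 ≤ t * (b - a) ^ 2 := by
    nlinarith [mul_nonneg (sub_nonneg.mpr ht.1) (sub_nonneg.mpr ht.2)]
  have h3 : 2 * (t - a * b) ^ 2 / (t * (b - a) ^ 2) ≤ 2 := by
    rw [div_le_iff₀ (by positivity)]; linarith
  have h4 : 0 ≤ 2 * (t - a * b) ^ 2 / (t * (b - a) ^ 2) := by positivity
  unfold laurentMap
  rw [abs_le]; constructor <;> linarith

theorem laurentMap_eq {a b t : ℝ} (hab : a < b) (ht : t ≠ 0) :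
    laurentMap a b t = (1 + 4 * a * b / (b - a) ^ 2) + -2 / (b - a) ^ 2 * t
      + -2 * (a * b) ^ 2 / (b - a) ^ 2 * t⁻¹ := by
  have h1 : b - a ≠ 0 := (sub_pos.mpr hab).ne'
  unfold laurentMap
  field_simp
  ring

/-- With `φ = Φ(t)`, the numerator of the Joukowski map factors as `P Q`, and the same two factors
form the Blaschke quotient. This makes later identities in `E` rational in `φ`. -/
theorem rateE_neg_eq {a b t : ℝ} (ha : 0 < a) (hab : a < b)
    (ht : t ∉ Set.Icc (a ^ 2) (b ^ 2)) :
    ∃ φ P Q : ℝ, 1 < |φ| ∧ P = (b + a) * φ + (b - a) ∧ Q = (b - a) * φ + (b + a) ∧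
      t = P * Q / (4 * φ) ∧ |Q| < |P| ∧ rateE (a ^ 2) (b ^ 2) (-t) = -(Q / (φ * P)) := by
  have hlL : a ^ 2 < b ^ 2 := by nlinarith
  have h1 : 0 < b - a := sub_pos.mpr hab
  have hφ := one_lt_abs_joukowskiPhi hlL ht
  have hψ := joukowskiPsi_joukowskiPhi hlL ht
  set φ := joukowskiPhi (a ^ 2) (b ^ 2) t with hφdef
  have hφ0 : φ ≠ 0 := by rintro h; rw [h, abs_zero] at hφ; linarith
  have hQP : |(b - a) * φ + (b + a)| < |(b + a) * φ + (b - a)| := by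
    -- `P² - Q² = 4ab(φ² - 1)`.
    apply sq_lt_sq.mp
    have : 1 < φ ^ 2 := by rw [← sq_abs]; nlinarith
    have : 0 < a * b := mul_pos ha (by linarith)
    nlinarith [mul_pos this (sub_pos.mpr ‹1 < φ ^ 2›)]
  have hP : (b + a) * φ + (b - a) ≠ 0 := abs_pos.mp ((abs_nonneg _).trans_lt hQP)
  refine ⟨φ, _, _, hφ, rfl, rfl, ?_, hQP, ?_⟩
  · rw [← hψ]; unfold joukowskiPsi; field_simp; ring
  · unfold rateE blaschkeB
    rw [neg_neg, ← hφdef, joukowskiPhi_zero ha hab]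
    have hden : -((b + a) / (b - a)) - φ⁻¹ = -((b + a) * φ + (b - a)) / ((b - a) * φ) := by
      field_simp; ring
    have hnum : 1 - -((b + a) / (b - a)) * φ⁻¹ = ((b - a) * φ + (b + a)) / ((b - a) * φ) := by
      field_simp; ring
    rw [hden, hnum, div_div_div_cancel_right₀ (mul_ne_zero h1.ne' hφ0), div_neg, mul_neg,
      inv_mul_eq_div, div_div, mul_comm φ]

theorem abs_rateE_lt_one {a b t : ℝ} (ha : 0 < a) (hab : a < b)
    (ht : t ∉ Set.Icc (a ^ 2) (b ^ 2)) : |rateE (a ^ 2) (b ^ 2) (-t)| < 1 := by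
  obtain ⟨φ, P, Q, hφ, -, -, -, hQP, hE⟩ := rateE_neg_eq ha hab ht
  have hP : 0 < |P| := (abs_nonneg _).trans_lt hQP
  rw [hE, abs_neg, abs_div, abs_mul, div_lt_one (by positivity)]
  nlinarith

theorem rateE_add_inv {a b t : ℝ} (ha : 0 < a) (hab : a < b)
    (ht : t ∉ Set.Icc (a ^ 2) (b ^ 2)) (ht0 : t ≠ 0) :
    rateE (a ^ 2) (b ^ 2) (-t) ≠ 0 ∧
      rateE (a ^ 2) (b ^ 2) (-t) + (rateE (a ^ 2) (b ^ 2) (-t))⁻¹ = 2 * laurentMap a b t := by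
  obtain ⟨φ, P, Q, hφ, hP, hQ, rfl, hQP, hE⟩ := rateE_neg_eq ha hab ht
  have h1 : b - a ≠ 0 := (sub_pos.mpr hab).ne'
  have hφ0 : φ ≠ 0 := by rintro rfl; simp at ht0
  have hP0 : P ≠ 0 := by rintro rfl; simp at ht0
  have hQ0 : Q ≠ 0 := by rintro rfl; simp at ht0
  have key : P * Q - 4 * a * b * φ = (b - a) * (Q + φ * P) := by rw [hP, hQ]; ring
  have h2 : P * Q / (4 * φ) - a * b = (b - a) * (Q + φ * P) / (4 * φ) := by
    rw [← key]; field_simp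
  rw [hE]
  refine ⟨neg_ne_zero.mpr (div_ne_zero hQ0 (mul_ne_zero hφ0 hP0)), ?_⟩
  unfold laurentMap
  rw [h2, inv_neg, inv_div]
  field_simp
  ring

theorem le_of_add_inv_le {u v : ℝ} (hu : 0 < u) (hu1 : u < 1) (hv : 0 < v) (hv1 : v < 1)
    (h : v + v⁻¹ ≤ u + u⁻¹) : u ≤ v := by
  by_contra! hlt
  have : u + u⁻¹ - (v + v⁻¹) = (u - v) * (u * v - 1) / (u * v) := by field_simp; ring
  have h2 : (u - v) * (u * v - 1) / (u * v) < 0 := by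
    apply div_neg_of_neg_of_pos _ (mul_pos hu hv)
    exact mul_neg_of_pos_of_neg (sub_pos.mpr hlt) (by nlinarith)
  linarith

theorem abs_rateE_add_inv {a b t : ℝ} (ha : 0 < a) (hab : a < b)
    (ht : t ∉ Set.Icc (a ^ 2) (b ^ 2)) (ht0 : t ≠ 0) :
    |rateE (a ^ 2) (b ^ 2) (-t)| + |rateE (a ^ 2) (b ^ 2) (-t)|⁻¹ = 2 * |laurentMap a b t| := by
  obtain ⟨h0, h⟩ := rateE_add_inv ha hab ht ht0
  rw [← abs_two, ← abs_mul, ← h]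
  rcases lt_or_gt_of_ne h0 with h1 | h1
  · rw [abs_of_neg h1, abs_of_neg (add_neg h1 (inv_lt_zero.mpr h1)), inv_neg]; ring
  · rw [abs_of_pos h1, abs_of_pos (add_pos h1 (inv_pos.mpr h1))]

theorem abs_rateE_le_of_laurentMap_le {a b t t' : ℝ} (ha : 0 < a) (hab : a < b)
    (ht : t ∉ Set.Icc (a ^ 2) (b ^ 2)) (ht0 : t ≠ 0)
    (ht' : t' ∉ Set.Icc (a ^ 2) (b ^ 2)) (ht'0 : t' ≠ 0)
    (h : |laurentMap a b t'| ≤ |laurentMap a b t|) :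
    |rateE (a ^ 2) (b ^ 2) (-t)| ≤ |rateE (a ^ 2) (b ^ 2) (-t')| := by
  apply le_of_add_inv_le (abs_pos.mpr (rateE_add_inv ha hab ht ht0).1)
    (abs_rateE_lt_one ha hab ht) (abs_pos.mpr (rateE_add_inv ha hab ht' ht'0).1)
    (abs_rateE_lt_one ha hab ht')
  rw [abs_rateE_add_inv ha hab ht ht0, abs_rateE_add_inv ha hab ht' ht'0]
  linarith

/-- For positive arguments outside `[a², b²]` the modulus of `laurentMap` is monotone in
`(t - a b)² / t`. -/
theorem abs_laurentMap_le_abs {a b t t' : ℝ} (ha : 0 < a) (hab : a < b) (ht0 : 0 < t)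
    (ht'0 : 0 < t') (ht' : t' ∉ Set.Icc (a ^ 2) (b ^ 2))
    (h : 0 ≤ (t - t') * (t * t' - (a * b) ^ 2)) :
    |laurentMap a b t'| ≤ |laurentMap a b t| := by
  have h1 : 0 < b - a := sub_pos.mpr hab
  have hmono : laurentMap a b t ≤ laurentMap a b t' := by
    have : laurentMap a b t' - laurentMap a b t
        = 2 * ((t - t') * (t * t' - (a * b) ^ 2)) / (t * t' * (b - a) ^ 2) := by
      unfold laurentMap; field_simp; ring
    have : 0 ≤ laurentMap a b t' - laurentMap a b t := by rw [this]; positivity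
    linarith
  have hneg : laurentMap a b t' ≤ -1 := by
    have h2 : 2 ≤ 2 * (t' - a * b) ^ 2 / (t' * (b - a) ^ 2) := by
      rw [le_div_iff₀ (by positivity)]
      have : 0 ≤ (t' - a ^ 2) * (t' - b ^ 2) := by
        rw [Set.mem_Icc, not_and_or, not_le, not_le] at ht'
        have hlL : a ^ 2 < b ^ 2 := by nlinarith
        rcases ht' with h | h
        · exact mul_nonneg_of_nonpos_of_nonpos (by linarith) (by linarith)
        · exact mul_nonneg (by linarith) (by linarith)
      nlinarith
    unfold laurentMap; linarith
  rw [abs_of_neg (by linarith), abs_of_neg (by linarith)]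
  linarith

/-- By AM-GM, `y(t) - 1` is smallest over `t < 0` at `t = -ab`, with value `8ab / (b - a)²`; there
`|E|` equals the stated bound, the source of the third term of `μ`. -/
theorem abs_rateE_le_of_neg {a b t k : ℝ} (ha : 0 < a) (hab : a < b) (ht : t < 0)
    (hk : 1 < k) (hkab : b = k ^ 2 * a) :
    |rateE (a ^ 2) (b ^ 2) (-t)| ≤ ((k - 1) / (k + 1)) ^ 2 := by
  have ht' : t ∉ Set.Icc (a ^ 2) (b ^ 2) := fun h => by nlinarith [h.1, sq_nonneg a]
  have h1 : 0 < b - a := sub_pos.mpr hab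
  have hk1 : 0 < k - 1 := sub_pos.mpr hk
  apply le_of_add_inv_le (abs_pos.mpr (rateE_add_inv ha hab ht' ht.ne).1)
    (abs_rateE_lt_one ha hab ht') (by positivity)
  · rw [sq_lt_one_iff_abs_lt_one, abs_of_pos (by positivity), div_lt_one (by positivity)]
    linarith
  rw [abs_rateE_add_inv ha hab ht' ht.ne]
  have h2 : ((k - 1) / (k + 1)) ^ 2 + (((k - 1) / (k + 1)) ^ 2)⁻¹
      = 2 * (1 + 8 * (a * b) / (b - a) ^ 2) := by
    have h3 : b - a = (k - 1) * (k + 1) * a := by rw [hkab]; ring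
    rw [h3, hkab]; field_simp; ring
  have h4 : 8 * (a * b) / (b - a) ^ 2 ≤ laurentMap a b t - 1 := by
    have : laurentMap a b t - 1 - 8 * (a * b) / (b - a) ^ 2
        = 2 * (t + a * b) ^ 2 / (-t * (b - a) ^ 2) := by
      have := ht.ne
      unfold laurentMap; field_simp; ring
    have h5 : 0 ≤ 2 * (t + a * b) ^ 2 / (-t * (b - a) ^ 2) := by
      have : 0 < -t := by linarith
      positivity
    linarith
  rw [h2]
  linarith [le_abs_self (laurentMap a b t)]

/-! ### Growth of Chebyshev polynomials. -/

theorem Polynomial.Chebyshev.eval_T_of_add_inv {e y : ℝ} (he : e ≠ 0) (h : e + e⁻¹ = 2 * y)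
    (m : ℕ) : 2 * (T ℝ m).eval y = e ^ m + (e⁻¹) ^ m := by
  induction m using Nat.strong_induction_on with
  | _ m ih =>
    match m, ih with
    | 0, _ => simp; norm_num
    | 1, _ => simp [h]
    | m + 2, ih =>
      have h1 := ih (m + 1) (by omega)
      have h0 := ih m (by omega)
      push_cast at h1 ⊢
      rw [T_add_two]
      simp only [eval_sub, eval_mul, eval_X, eval_ofNat]
      have hee : e * e⁻¹ = 1 := mul_inv_cancel₀ he
      calc 2 * (2 * y * (T ℝ (m + 1)).eval y - (T ℝ m).eval y)
          = 2 * y * (2 * (T ℝ (m + 1)).eval y) - 2 * (T ℝ m).eval y := by ring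
        _ = (e + e⁻¹) * (e ^ (m + 1) + e⁻¹ ^ (m + 1)) - (e ^ m + e⁻¹ ^ m) := by
          rw [h1, h0, h]
        _ = e ^ (m + 2) + e⁻¹ ^ (m + 2) + (e * e⁻¹ - 1) * (e ^ m + e⁻¹ ^ m) := by ring
        _ = _ := by rw [hee]; ring

/-- Multiplying `2 T_m(y) = e^m + e^(-m)` by `e^m` gives `e^(2m) + 1 ≥ 1`. -/
theorem Polynomial.Chebyshev.le_abs_eval_T_of_add_inv {e y : ℝ} (he : e ≠ 0)
    (h : e + e⁻¹ = 2 * y) (m : ℕ) : 1 ≤ 2 * |e| ^ m * |(T ℝ m).eval y| := by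
  have h1 : 2 * e ^ m * (T ℝ m).eval y = (e ^ m) ^ 2 + 1 := by
    have hee : e ^ m * (e⁻¹) ^ m = 1 := by rw [← mul_pow, mul_inv_cancel₀ he, one_pow]
    linear_combination e ^ m * eval_T_of_add_inv he h m + hee
  have h2 : 2 * |e| ^ m * |(T ℝ m).eval y| = |2 * e ^ m * (T ℝ m).eval y| := by
    rw [abs_mul, abs_mul, abs_pow, abs_two]
  rw [h2, h1]
  exact le_trans (by nlinarith [sq_nonneg (e ^ m)]) (le_abs_self _)

/-! ### Bounds on the rate. -/

theorem sqrt_sqrt_ratio {a b : ℝ} (ha : 0 < a) (hab : a < b) :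
    ∃ k : ℝ, 1 < k ∧ b = k ^ 2 * a ∧ (b ^ 2 / a ^ 2) ^ (1 / 4 : ℝ) = k := by
  have h1 : 1 < b / a := (one_lt_div ha).mpr hab
  have h0 : 0 ≤ b / a := by linarith
  refine ⟨√(b / a), Real.lt_sqrt_of_sq_lt (by simpa using h1), ?_, ?_⟩
  · rw [Real.sq_sqrt h0]; field_simp
  · rw [← div_pow, Real.sqrt_eq_rpow, ← Real.rpow_natCast, ← Real.rpow_mul h0]
    norm_num

theorem manifoldRate_pos {a b δ1 δn : ℝ} (ha : 0 < a) (hab : a < b) :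
    0 < manifoldRate (a ^ 2) (b ^ 2) δ1 δn := by
  obtain ⟨k, hk, -, hk'⟩ := sqrt_sqrt_ratio ha hab
  unfold manifoldRate
  rw [hk']
  exact lt_of_lt_of_le (div_pos (by linarith) (by linarith)) (le_max_right _ _)

theorem manifoldRate_lt_one {a b δ1 δn : ℝ} (ha : 0 < a) (hab : a < b) (hδ1 : 0 < δ1)
    (hδn : 0 < δn) : manifoldRate (a ^ 2) (b ^ 2) δ1 δn < 1 := by
  obtain ⟨k, hk, -, hk'⟩ := sqrt_sqrt_ratio ha hab
  unfold manifoldRate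
  rw [hk']
  have h (t : ℝ) (ht : t ∉ Set.Icc (a ^ 2) (b ^ 2)) : √|rateE (a ^ 2) (b ^ 2) (-t)| < 1 := by
    rw [Real.sqrt_lt' one_pos, one_pow]
    exact abs_rateE_lt_one ha hab ht
  refine max_lt (max_lt ?_ ?_) ?_
  · rw [← neg_add']
    exact h (b ^ 2 + δn) (fun h => by linarith [h.2])
  · rw [← sub_neg_eq_add, ← neg_sub']
    exact h (a ^ 2 - δ1) (fun h => by linarith [h.1])
  · rw [div_lt_one (by linarith)]; linarith

theorem abs_rateE_le_manifoldRate_sq {a b δ1 δn σ : ℝ} (ha : 0 < a) (hab : a < b)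
    (hδ1 : 0 < δ1) (hδn : 0 < δn) (hσ : σ ∉ Set.Ioo (-b ^ 2 - δn) (-a ^ 2 + δ1))
    (hσ0 : σ ≠ 0) :
    |rateE (a ^ 2) (b ^ 2) σ| ≤ manifoldRate (a ^ 2) (b ^ 2) δ1 δn ^ 2 := by
  obtain ⟨k, hk, hkab, hk'⟩ := sqrt_sqrt_ratio ha hab
  have hlL : a ^ 2 < b ^ 2 := by nlinarith
  have ha2 : 0 < a ^ 2 := by positivity
  have hsq (σ' : ℝ) (h : √|rateE (a ^ 2) (b ^ 2) σ'| ≤ manifoldRate (a ^ 2) (b ^ 2) δ1 δn) :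
      |rateE (a ^ 2) (b ^ 2) σ'| ≤ manifoldRate (a ^ 2) (b ^ 2) δ1 δn ^ 2 := by
    rw [← Real.sq_sqrt (abs_nonneg (rateE (a ^ 2) (b ^ 2) σ'))]
    exact pow_le_pow_left₀ (Real.sqrt_nonneg _) h 2
  obtain ⟨t, rfl⟩ : ∃ t, σ = -t := ⟨-σ, by ring⟩
  have ht0 : t ≠ 0 := by simpa using hσ0
  rw [Set.mem_Ioo, not_and_or, not_lt, not_lt] at hσ
  rcases hσ with h | h
  · have ht : t ∉ Set.Icc (a ^ 2) (b ^ 2) := fun h' => by linarith [h'.2]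
    have ht' : b ^ 2 + δn ∉ Set.Icc (a ^ 2) (b ^ 2) := fun h' => by linarith [h'.2]
    have h' : |rateE (a ^ 2) (b ^ 2) (-t)| ≤ |rateE (a ^ 2) (b ^ 2) (-(b ^ 2 + δn))| := by
      apply abs_rateE_le_of_laurentMap_le ha hab ht ht0 ht' (by positivity)
      apply abs_laurentMap_le_abs ha hab (by linarith) (by positivity) ht'
      have h1 : b ^ 2 ≤ t := by linarith
      have h2 : b ^ 2 * b ^ 2 ≤ t * (b ^ 2 + δn) :=
        mul_le_mul h1 (by linarith) (by positivity) (by linarith)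
      exact mul_nonneg (by linarith) (by nlinarith)
    refine h'.trans (hsq _ ?_)
    rw [neg_add']
    exact (le_max_left _ _).trans (le_max_left _ _)
  · rcases lt_or_gt_of_ne ht0 with htneg | htpos
    · refine (abs_rateE_le_of_neg ha hab htneg hk hkab).trans ?_
      apply pow_le_pow_left₀ (div_nonneg (by linarith) (by linarith))
      unfold manifoldRate
      rw [hk']
      exact le_max_right _ _
    · have ht : t ∉ Set.Icc (a ^ 2) (b ^ 2) := fun h' => by linarith [h'.1]
      have ht' : a ^ 2 - δ1 ∉ Set.Icc (a ^ 2) (b ^ 2) := fun h' => by linarith [h'.1]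
      have h' : |rateE (a ^ 2) (b ^ 2) (-t)| ≤ |rateE (a ^ 2) (b ^ 2) (-(a ^ 2 - δ1))| := by
        -- If `δ1 ≥ a²` this case is empty, so the endpoint may be assumed positive.
        have hpos : 0 < a ^ 2 - δ1 := by linarith
        apply abs_rateE_le_of_laurentMap_le ha hab ht ht0 ht' hpos.ne'
        apply abs_laurentMap_le_abs ha hab htpos hpos ht'
        have h1 : t ≤ a ^ 2 := by linarith
        have h2 : t * (a ^ 2 - δ1) ≤ a ^ 2 * a ^ 2 :=
          mul_le_mul h1 (by linarith) hpos.le (by positivity)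
        exact mul_nonneg_of_nonpos_of_nonpos (by linarith) (by nlinarith)
      refine h'.trans (hsq _ ?_)
      rw [neg_sub', sub_neg_eq_add]
      exact (le_max_right _ _).trans (le_max_left _ _)

/-! ### Laurent polynomials in a symmetric matrix. -/

theorem OrthonormalBasis.norm_apply_le_of_eigenvectors {ι E : Type*} [Fintype ι]
    [NormedAddCommGroup E] [InnerProductSpace ℝ E] (v : OrthonormalBasis ι ℝ E) (f : E →ₗ[ℝ] E)
    (c : ι → ℝ) (hf : ∀ i, f (v i) = c i • v i) {K : ℝ} (hK : 0 ≤ K) (hc : ∀ i, |c i| ≤ K)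
    (x : E) : ‖f x‖ ≤ K * ‖x‖ := by
  classical
  have hrepr (i : ι) : inner ℝ (v i) (f x) = c i * inner ℝ (v i) x := by
    conv_lhs => rw [← v.sum_repr x, map_sum, inner_sum]
    simp only [map_smul, hf, inner_smul_right, v.inner_eq_ite, v.repr_apply_apply]
    simp [mul_comm]
  refine (sq_le_sq₀ (norm_nonneg _) (by positivity)).mp ?_
  rw [mul_pow, ← v.sum_sq_inner_right, ← v.sum_sq_inner_right, Finset.mul_sum]
  refine Finset.sum_le_sum fun i _ => ?_
  rw [hrepr, mul_pow]
  exact mul_le_mul_of_nonneg_right (sq_le_sq' (neg_le_of_abs_le (hc i)) (le_of_abs_le (hc i)))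
    (sq_nonneg _)

namespace Matrix

variable {n : ℕ}

/-- The span of the powers `A ^ k` with `-p ≤ k ≤ q`. -/
noncomputable def laurentSpan (A : Matrix (Fin n) (Fin n) ℝ) (p q : ℤ) :
    Submodule ℝ (Matrix (Fin n) (Fin n) ℝ) :=
  Submodule.span ℝ ((fun k : ℤ => A ^ k) '' Set.Icc (-p) q)

theorem zpow_mem_laurentSpan (A : Matrix (Fin n) (Fin n) ℝ) {p q k : ℤ} (h1 : -p ≤ k)
    (h2 : k ≤ q) : A ^ k ∈ A.laurentSpan p q :=
  Submodule.subset_span ⟨k, ⟨h1, h2⟩, rfl⟩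

theorem laurentSpan_mono (A : Matrix (Fin n) (Fin n) ℝ) {p q p' q' : ℤ} (hp : p ≤ p')
    (hq : q ≤ q') : A.laurentSpan p q ≤ A.laurentSpan p' q' :=
  Submodule.span_mono (Set.image_mono (Set.Icc_subset_Icc (neg_le_neg hp) hq))

theorem one_mem_laurentSpan (A : Matrix (Fin n) (Fin n) ℝ) {p q : ℤ} (hp : 0 ≤ p)
    (hq : 0 ≤ q) : 1 ∈ A.laurentSpan p q := by
  have := zpow_mem_laurentSpan A (p := p) (q := q) (k := 0) (by omega) hq
  rwa [zpow_zero] at this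

theorem mul_mem_laurentSpan {A M N : Matrix (Fin n) (Fin n) ℝ} (hA : IsUnit A.det)
    {p q p' q' : ℤ} (hM : M ∈ A.laurentSpan p q) (hN : N ∈ A.laurentSpan p' q') :
    M * N ∈ A.laurentSpan (p + p') (q + q') := by
  have h := Submodule.mul_mem_mul hM hN
  unfold laurentSpan at h
  rw [Submodule.span_mul_span] at h
  refine Submodule.span_mono ?_ h
  rintro _ ⟨_, ⟨i, hi, rfl⟩, _, ⟨j, hj, rfl⟩, rfl⟩
  refine ⟨i + j, ⟨?_, add_le_add hi.2 hj.2⟩, zpow_add hA i j⟩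
  have := hi.1
  have := hj.1
  omega

theorem aeval_mem_laurentSpan {A Y : Matrix (Fin n) (Fin n) ℝ} (hA : IsUnit A.det)
    (hY : Y ∈ A.laurentSpan 1 1) {P : Polynomial ℝ} {d : ℕ} (hP : P.natDegree ≤ d) :
    Polynomial.aeval Y P ∈ A.laurentSpan d d := by
  have hpow (i : ℕ) : Y ^ i ∈ A.laurentSpan i i := by
    induction i with
    | zero => exact one_mem_laurentSpan A le_rfl le_rfl
    | succ i ih => rw [pow_succ]; exact_mod_cast mul_mem_laurentSpan hA ih hY
  rw [Polynomial.aeval_eq_sum_range]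
  refine Submodule.sum_mem _ fun i hi => Submodule.smul_mem _ _ ?_
  have : (i : ℤ) ≤ d := by have := Finset.mem_range.mp hi; omega
  exact laurentSpan_mono A this this (hpow i)

/-- The first `2m` generators carry exactly the powers `-m, …, m - 1`. The upper limit is an
integer, so `m = 0` gives an empty range. -/
theorem toLp_mulVec_mem_extKrylov {A M : Matrix (Fin n) (Fin n) ℝ}
    (b : EuclideanSpace ℝ (Fin n)) {m : ℕ} (hM : M ∈ A.laurentSpan m (m - 1)) :
    WithLp.toLp 2 (M.mulVec b.ofLp) ∈ extKrylov A b (2 * m) := by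
  induction hM using Submodule.span_induction with
  | zero => simp
  | add M N _ _ hM hN => rw [add_mulVec, WithLp.toLp_add]; exact add_mem hM hN
  | smul c M _ hM => rw [smul_mulVec, WithLp.toLp_smul]; exact Submodule.smul_mem _ _ hM
  | mem M hM =>
    obtain ⟨k, ⟨hk1, hk2⟩, rfl⟩ := hM
    apply Submodule.subset_span
    obtain ⟨i, rfl | rfl⟩ := k.eq_nat_or_neg
    · refine ⟨2 * i, by simp only [Set.mem_ofPred_eq]; omega, ?_⟩
      rw [extKrylovVec, if_pos (even_two_mul i), Nat.mul_div_cancel_left i two_pos]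
      simp
    · rcases i with _ | i
      · refine ⟨0, by simp only [Set.mem_ofPred_eq]; omega, by simp [extKrylovVec]⟩
      · refine ⟨2 * i + 1, by simp only [Set.mem_ofPred_eq]; omega, ?_⟩
        have h : ¬ Even (2 * i + 1) := by simp
        have h2 : (2 * i + 1 + 1) / 2 = i + 1 := by omega
        rw [extKrylovVec, if_neg h, h2]
        simp only [zpow_neg_natCast, inv_pow']

section Eigenvector

variable {M N : Matrix (Fin n) (Fin n) ℝ} {v : Fin n → ℝ} {c d : ℝ}

theorem mul_mulVec_of_eigenvector (hM : M.mulVec v = c • v) (hN : N.mulVec v = d • v) :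
    (M * N).mulVec v = (c * d) • v := by
  rw [← mulVec_mulVec, hN, mulVec_smul, hM, smul_smul, mul_comm]

theorem inv_mulVec_of_eigenvector (h : IsUnit M) (hc : c ≠ 0) (hM : M.mulVec v = c • v) :
    M⁻¹.mulVec v = c⁻¹ • v := by
  have h1 : M⁻¹.mulVec (M.mulVec v) = v := by
    rw [mulVec_mulVec, nonsing_inv_mul _ ((isUnit_iff_isUnit_det _).mp h), one_mulVec]
  rw [hM, mulVec_smul] at h1
  rw [← h1, smul_smul, inv_mul_cancel₀ hc, one_smul, h1]

theorem aeval_mulVec_of_eigenvector (hM : M.mulVec v = c • v) (P : Polynomial ℝ) :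
    (Polynomial.aeval M P).mulVec v = P.eval c • v := by
  induction P using Polynomial.induction_on' with
  | add P Q hP hQ => rw [map_add, add_mulVec, hP, hQ, Polynomial.eval_add, add_smul]
  | monomial i a =>
    have hpow : (M ^ i).mulVec v = c ^ i • v := by
      induction i with
      | zero => simp
      | succ i ih => rw [pow_succ, pow_succ, mul_mulVec_of_eigenvector ih hM]
    rw [Polynomial.aeval_monomial, ← Algebra.smul_def, smul_mulVec, hpow,
      Polynomial.eval_monomial, smul_smul]

end Eigenvector

theorem isUnit_add_smul_one {A : Matrix (Fin n) (Fin n) ℝ} {σ : ℝ} (h : -σ ∉ spectrum ℝ A) :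
    IsUnit (A + σ • (1 : Matrix (Fin n) (Fin n) ℝ)) := by
  rw [spectrum.notMem_iff, ← IsUnit.neg_iff] at h
  convert h using 1
  rw [Algebra.algebraMap_eq_smul_one, neg_smul]
  abel

/-- An eigenbasis of `A` diagonalizes the product, reducing the estimate to scalars on the spectrum.
-/
theorem norm_toLp_inv_mul_mulVec_le {A N : Matrix (Fin n) (Fin n) ℝ} (hA : A.IsHermitian)
    {σ δ K : ℝ} (hδ : 0 < δ) (hK : 0 ≤ K) (f : ℝ → ℝ)
    (hσ : ∀ x ∈ spectrum ℝ A, δ ≤ |x + σ|) (hf : ∀ x ∈ spectrum ℝ A, |f x| ≤ K)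
    (hN : ∀ x ∈ spectrum ℝ A, ∀ v : Fin n → ℝ, A.mulVec v = x • v → N.mulVec v = f x • v)
    (b : EuclideanSpace ℝ (Fin n)) :
    ‖WithLp.toLp 2 (((A + σ • (1 : Matrix (Fin n) (Fin n) ℝ))⁻¹ * N).mulVec b.ofLp)‖
      ≤ K / δ * ‖b‖ := by
  have hunit : IsUnit (A + σ • (1 : Matrix (Fin n) (Fin n) ℝ)) :=
    isUnit_add_smul_one fun h => by
      have := hσ _ h
      rw [neg_add_cancel, abs_zero] at this
      linarith
  rw [← toLpLin_apply]
  refine hA.eigenvectorBasis.norm_apply_le_of_eigenvectors _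
    (fun i => (hA.eigenvalues i + σ)⁻¹ * f (hA.eigenvalues i)) (fun i => ?_) (by positivity)
    (fun i => ?_) b
  · have hx := hA.eigenvalues_mem_spectrum_real i
    have hne : hA.eigenvalues i + σ ≠ 0 := abs_pos.mp (hδ.trans_le (hσ _ hx))
    have hv := hA.mulVec_eigenvectorBasis i
    rw [toLpLin_apply, mul_mulVec_of_eigenvector (inv_mulVec_of_eigenvector hunit hne _)
      (hN _ hx _ hv)]
    · rfl
    · rw [add_mulVec, smul_mulVec, one_mulVec, hv, add_smul]
  · have hx := hA.eigenvalues_mem_spectrum_real i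
    rw [abs_mul, abs_inv, inv_mul_eq_div]
    exact div_le_div₀ hK (hf _ hx) hδ (hσ _ hx)

end Matrix

/-! ### Approximation of the shifted solutions. -/

theorem norm_shiftedSolution_le {n : ℕ} {A : Matrix (Fin n) (Fin n) ℝ} (hA : A.IsHermitian)
    {σ δ : ℝ} (hδ : 0 < δ) (hσ : ∀ x ∈ spectrum ℝ A, δ ≤ |x + σ|)
    (b : EuclideanSpace ℝ (Fin n)) : ‖shiftedSolution A b σ‖ ≤ 1 / δ * ‖b‖ := by
  have := Matrix.norm_toLp_inv_mul_mulVec_le (N := 1) hA hδ zero_le_one (fun _ => 1) hσ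
    (by simp) (by simp) b
  rwa [mul_one] at this

/-- The approximation by Laurent polynomials `(x + σ)⁻¹ (1 - T_m (y x) / T_m (y (-σ)))`, where
`y` is `laurentMap`. -/
theorem exists_mem_extKrylov_norm_sub_le {n m : ℕ} {A : Matrix (Fin n) (Fin n) ℝ}
    {α β σ δ τ : ℝ} (hα : 0 < α) (hαβ : α < β) (hA : A.IsHermitian)
    (hspec : spectrum ℝ A ⊆ Set.Icc (α ^ 2) (β ^ 2)) (hm : m ≠ 0) (hσ0 : σ ≠ 0) (hδ : 0 < δ)
    (hσ : ∀ x ∈ spectrum ℝ A, δ ≤ |x + σ|)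
    (hτ : τ = (Polynomial.Chebyshev.T ℝ m).eval (laurentMap α β (-σ))) (hτ0 : τ ≠ 0)
    (b : EuclideanSpace ℝ (Fin n)) :
    ∃ x ∈ extKrylov A b (2 * m), ‖x - shiftedSolution A b σ‖ ≤ |τ|⁻¹ / δ * ‖b‖ := by
  have hunit : IsUnit (A + σ • (1 : Matrix (Fin n) (Fin n) ℝ)) :=
    Matrix.isUnit_add_smul_one fun h => by
      have := hσ _ h
      rw [neg_add_cancel, abs_zero] at this
      linarith
  have hα2 : 0 < α ^ 2 := by positivity
  have hAunit : IsUnit A := by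
    have := Matrix.isUnit_add_smul_one (A := A) (σ := 0) fun h => by
      have := (hspec h).1
      linarith
    simpa using this
  have hAdet := (Matrix.isUnit_iff_isUnit_det _).mp hAunit
  set c0 : ℝ := 1 + 4 * α * β / (β - α) ^ 2 with hc0
  set c1 : ℝ := -2 / (β - α) ^ 2 with hc1
  set c2 : ℝ := -2 * (α * β) ^ 2 / (β - α) ^ 2 with hc2
  have hy (x : ℝ) (hx : x ≠ 0) : laurentMap α β x = c0 + c1 * x + c2 * x⁻¹ :=
    laurentMap_eq hαβ hx
  set Y : Matrix (Fin n) (Fin n) ℝ := c0 • 1 + c1 • A + c2 • A⁻¹ with hYdef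
  have hinv {p q : ℤ} (hp : 1 ≤ p) (hq : 0 ≤ q) : A⁻¹ ∈ A.laurentSpan p q := by
    have := Matrix.zpow_mem_laurentSpan A (p := p) (q := q) (k := -1) (by omega) (by omega)
    rwa [Matrix.zpow_neg_one] at this
  have hY : Y ∈ A.laurentSpan 1 1 := by
    refine add_mem (add_mem (Submodule.smul_mem _ _ ?_) (Submodule.smul_mem _ _ ?_))
      (Submodule.smul_mem _ _ (hinv le_rfl zero_le_one))
    · exact A.one_mem_laurentSpan zero_le_one zero_le_one
    · have := Matrix.zpow_mem_laurentSpan A (p := 1) (q := 1) (k := 1) (by omega) le_rfl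
      rwa [zpow_one] at this
  set S := Polynomial.Chebyshev.T ℝ m
  set Q : Polynomial ℝ := 1 - Polynomial.C τ⁻¹ * S with hQ
  have hroot : Q.IsRoot (laurentMap α β (-σ)) := by
    simp [hQ, Polynomial.IsRoot, ← hτ, hτ0]
  set Q1 := Q /ₘ (Polynomial.X - Polynomial.C (laurentMap α β (-σ))) with hQ1
  have hfac := Polynomial.mul_divByMonic_eq_iff_isRoot.mpr hroot
  have hdeg : Q1.natDegree ≤ m - 1 := by
    rw [hQ1, Polynomial.natDegree_divByMonic _ (Polynomial.monic_X_sub_C _),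
      Polynomial.natDegree_X_sub_C]
    refine Nat.sub_le_sub_right ?_ 1
    refine (Polynomial.natDegree_sub_le _ _).trans (max_le (by simp) ?_)
    refine (Polynomial.natDegree_C_mul_le _ _).trans ?_
    simp [S, Polynomial.Chebyshev.natDegree_T]
  -- Dividing `y(x) - y(-σ)` by `x + σ` leaves only the powers `x⁻¹` and `1`; this keeps the top
  -- power of `M` at `m - 1`.
  have hYfac : Y - algebraMap ℝ _ (laurentMap α β (-σ))
      = (A + σ • 1) * (c1 • 1 + (c2 / σ) • A⁻¹) := by
    have h1 : A * A⁻¹ = 1 := Matrix.mul_nonsing_inv _ hAdet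
    rw [hYdef, hy _ (neg_ne_zero.mpr hσ0), Algebra.algebraMap_eq_smul_one]
    simp only [add_mul, mul_add, mul_smul_comm, smul_mul_assoc, mul_one, one_mul, h1]
    have h2 : c2 * (-σ)⁻¹ = -(c2 / σ) := by rw [inv_neg]; ring
    have h3 : c2 • A⁻¹ = (c2 / σ * σ) • A⁻¹ := by rw [div_mul_cancel₀ _ hσ0]
    rw [h2, h3]
    module
  set M : Matrix (Fin n) (Fin n) ℝ := (c1 • 1 + (c2 / σ) • A⁻¹) * Polynomial.aeval Y Q1 with hM
  have hMeq : (A + σ • 1) * M = Polynomial.aeval Y Q := by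
    conv_rhs => rw [← hfac]
    rw [map_mul, map_sub, Polynomial.aeval_X, Polynomial.aeval_C, hYfac, hM, mul_assoc]
  have hMmem : M ∈ A.laurentSpan m (m - 1) := by
    have h1 : c1 • 1 + (c2 / σ) • A⁻¹ ∈ A.laurentSpan 1 0 :=
      add_mem (Submodule.smul_mem _ _ (A.one_mem_laurentSpan zero_le_one le_rfl))
        (Submodule.smul_mem _ _ (hinv le_rfl le_rfl))
    -- `m ≠ 0` is needed here: the degree bound `m - 1` is a truncated subtraction.
    refine Matrix.laurentSpan_mono A ?_ ?_
      (Matrix.mul_mem_laurentSpan hAdet h1 (Matrix.aeval_mem_laurentSpan hAdet hY hdeg))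
    all_goals omega
  refine ⟨_, Matrix.toLp_mulVec_mem_extKrylov b hMmem, ?_⟩
  have hsub : M - (A + σ • 1)⁻¹ = -((A + σ • 1)⁻¹ * (τ⁻¹ • Polynomial.aeval Y S)) := by
    have h1 : (A + σ • 1)⁻¹ * ((A + σ • 1) * M) = M := by
      rw [← mul_assoc, Matrix.nonsing_inv_mul _ ((Matrix.isUnit_iff_isUnit_det _).mp hunit),
        one_mul]
    rw [hMeq, hQ, map_sub, map_one, map_mul, Polynomial.aeval_C, ← Algebra.smul_def, mul_sub,
      mul_one] at h1
    rw [← h1]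
    abel
  have herr : WithLp.toLp 2 (M.mulVec b.ofLp) - shiftedSolution A b σ
      = -WithLp.toLp 2 (((A + σ • 1)⁻¹ * (τ⁻¹ • Polynomial.aeval Y S)).mulVec b.ofLp) := by
    rw [shiftedSolution, ← WithLp.toLp_sub, ← Matrix.sub_mulVec, hsub, Matrix.neg_mulVec,
      WithLp.toLp_neg]
  rw [herr, norm_neg]
  refine Matrix.norm_toLp_inv_mul_mulVec_le hA hδ (by positivity)
    (fun x => τ⁻¹ * S.eval (laurentMap α β x)) hσ (fun x hx => ?_) (fun x hx v hv => ?_) b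
  · rw [abs_mul, abs_inv]
    exact mul_le_of_le_one_right (by positivity)
      (Polynomial.Chebyshev.abs_eval_T_real_le_one m (abs_laurentMap_le_one hα hαβ (hspec hx)))
  · have hx0 : x ≠ 0 := by have := (hspec hx).1; linarith
    have hYv : Y.mulVec v = laurentMap α β x • v := by
      rw [hYdef, hy x hx0, Matrix.add_mulVec, Matrix.add_mulVec, Matrix.smul_mulVec,
        Matrix.smul_mulVec, Matrix.smul_mulVec, Matrix.one_mulVec, hv,
        Matrix.inv_mulVec_of_eigenvector hAunit hx0 hv]
      module
    rw [Matrix.smul_mulVec, Matrix.aeval_mulVec_of_eigenvector hYv, smul_smul]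

theorem shiftedSolution_zero_mem_extKrylov {n j : ℕ} (A : Matrix (Fin n) (Fin n) ℝ)
    (b : EuclideanSpace ℝ (Fin n)) (hj : 1 < j) : shiftedSolution A b 0 ∈ extKrylov A b j :=
  Submodule.subset_span ⟨1, hj, by simp [extKrylovVec, shiftedSolution]⟩

theorem exists_mem_extKrylov_norm_sub_le_rate {n : ℕ} {A : Matrix (Fin n) (Fin n) ℝ}
    {α β δ1 δn σ δ : ℝ} (hα : 0 < α) (hαβ : α < β) (hδ1 : 0 < δ1) (hδn : 0 < δn)
    (hA : A.IsHermitian) (hspec : spectrum ℝ A ⊆ Set.Icc (α ^ 2) (β ^ 2))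
    (hσmem : σ ∉ Set.Ioo (-β ^ 2 - δn) (-α ^ 2 + δ1)) (hδ : 0 < δ)
    (hσ : ∀ x ∈ spectrum ℝ A, δ ≤ |x + σ|) (b : EuclideanSpace ℝ (Fin n)) (m : ℕ) :
    ∃ x ∈ extKrylov A b (2 * m), ‖x - shiftedSolution A b σ‖
      ≤ 2 / δ * ‖b‖ * manifoldRate (α ^ 2) (β ^ 2) δ1 δn ^ (2 * m) := by
  have hμ : 0 < manifoldRate (α ^ 2) (β ^ 2) δ1 δn := manifoldRate_pos hα hαβ
  rcases eq_or_ne m 0 with rfl | hm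
  · refine ⟨0, zero_mem _, ?_⟩
    rw [zero_sub, norm_neg, mul_zero, pow_zero, mul_one]
    refine (norm_shiftedSolution_le hA hδ hσ b).trans ?_
    gcongr
    norm_num
  -- At `σ = 0` the map `y` has a pole, but `x(0) = A⁻¹ b` already lies in `K_2`.
  rcases eq_or_ne σ 0 with rfl | hσ0
  · refine ⟨_, shiftedSolution_zero_mem_extKrylov A b (by omega), ?_⟩
    rw [sub_self, norm_zero]
    positivity
  have ht : -σ ∉ Set.Icc (α ^ 2) (β ^ 2) := fun h => by
    apply hσmem
    constructor
    · linarith [h.2]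
    · linarith [h.1]
  obtain ⟨hE0, hE⟩ := rateE_add_inv hα hαβ ht (neg_ne_zero.mpr hσ0)
  have hT := Polynomial.Chebyshev.le_abs_eval_T_of_add_inv hE0 hE m
  have hle := abs_rateE_le_manifoldRate_sq hα hαβ hδ1 hδn hσmem hσ0
  rw [neg_neg] at hT
  set τ := (Polynomial.Chebyshev.T ℝ m).eval (laurentMap α β (-σ)) with hτ
  have hτ0 : τ ≠ 0 := by rintro h; rw [h, abs_zero, mul_zero] at hT; linarith
  obtain ⟨x, hx, hbound⟩ := exists_mem_extKrylov_norm_sub_le hα hαβ hA hspec hm hσ0 hδ hσ hτ hτ0 b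
  refine ⟨x, hx, hbound.trans ?_⟩
  have h1 : |τ|⁻¹ ≤ 2 * manifoldRate (α ^ 2) (β ^ 2) δ1 δn ^ (2 * m) := by
    have h2 : |τ|⁻¹ ≤ 2 * |rateE (α ^ 2) (β ^ 2) σ| ^ m := by
      rwa [inv_le_iff_one_le_mul₀ (abs_pos.mpr hτ0)]
    refine h2.trans ?_
    rw [pow_mul]
    gcongr
  calc |τ|⁻¹ / δ * ‖b‖
      ≤ 2 * manifoldRate (α ^ 2) (β ^ 2) δ1 δn ^ (2 * m) / δ * ‖b‖ := by gcongr
    _ = _ := by ring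

theorem mainTheorem2 (l L δ1 δn : ℝ) (hl : 0 < l) (hlL : l < L) (hδ1 : 0 < δ1) (hδn : 0 < δn) :
    manifoldRate l L δ1 δn < 1 ∧
    ∃ C : ℝ, ∀ (n : ℕ) (A : Matrix (Fin n) (Fin n) ℝ) (b : EuclideanSpace ℝ (Fin n)),
      A.PosDef → IsLeast (spectrum ℝ A) l → IsGreatest (spectrum ℝ A) L →
      ∀ σ : ℝ, σ ∉ Set.Ioo (-L - δn) (-l + δ1) →
        IsUnit (A + σ • (1 : Matrix (Fin n) (Fin n) ℝ)) ∧
        ∀ j : ℕ, ∃ x ∈ extKrylov A b j,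
          ‖x - shiftedSolution A b σ‖ ≤ C * ‖b‖ * manifoldRate l L δ1 δn ^ j := by
  obtain ⟨α, hα, rfl⟩ : ∃ α : ℝ, 0 < α ∧ l = α ^ 2 :=
    ⟨√l, Real.sqrt_pos.mpr hl, (Real.sq_sqrt hl.le).symm⟩
  obtain ⟨β, hβ, rfl⟩ : ∃ β : ℝ, 0 < β ∧ L = β ^ 2 :=
    ⟨√L, Real.sqrt_pos.mpr (hl.trans hlL), (Real.sq_sqrt (hl.trans hlL).le).symm⟩
  have hαβ : α < β := lt_of_pow_lt_pow_left₀ 2 hβ.le hlL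
  have hμ1 := manifoldRate_lt_one hα hαβ hδ1 hδn
  have hμ : 0 < manifoldRate (α ^ 2) (β ^ 2) δ1 δn := manifoldRate_pos hα hαβ
  -- The 2 comes from the Chebyshev bound, `min δ1 δn` bounds the distance from `-σ` to the
  -- spectrum, and the factor `1 / μ` pays for rounding an odd `j` down.
  refine ⟨hμ1, 2 / min δ1 δn / manifoldRate (α ^ 2) (β ^ 2) δ1 δn,
    fun n A b hA hmin hmax σ hσ => ?_⟩
  set μ := manifoldRate (α ^ 2) (β ^ 2) δ1 δn
  have hδ : 0 < min δ1 δn := lt_min hδ1 hδn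
  have hspec : spectrum ℝ A ⊆ Set.Icc (α ^ 2) (β ^ 2) := fun x hx => ⟨hmin.2 hx, hmax.2 hx⟩
  have hdist : ∀ x ∈ spectrum ℝ A, min δ1 δn ≤ |x + σ| := fun x hx => by
    have hx' := hspec hx
    rw [Set.mem_Ioo, not_and_or, not_lt, not_lt] at hσ
    rcases hσ with h | h
    · refine (min_le_right _ _).trans (le_abs.mpr (Or.inr ?_))
      linarith [hx'.2]
    · refine (min_le_left _ _).trans (le_abs.mpr (Or.inl ?_))
      linarith [hx'.1]
  refine ⟨Matrix.isUnit_add_smul_one fun h => ?_, fun j => ?_⟩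
  · have := hdist _ h
    rw [neg_add_cancel, abs_zero] at this
    linarith
  obtain ⟨x, hx, hbound⟩ := exists_mem_extKrylov_norm_sub_le_rate hα hαβ hδ1 hδn hA.isHermitian
    hspec hσ hδ hdist b (j / 2)
  have hsub : extKrylov A b (2 * (j / 2)) ≤ extKrylov A b j :=
    Submodule.span_mono (Set.image_mono fun i (hi : i < 2 * (j / 2)) => by
      simp only [Set.mem_ofPred_eq]; omega)
  refine ⟨x, hsub hx, hbound.trans ?_⟩
  have hpow : μ ^ (2 * (j / 2)) ≤ μ ^ j / μ := by
    rw [le_div_iff₀ hμ, ← pow_succ]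
    exact pow_le_pow_of_le_one hμ.le hμ1.le (by omega)
  calc 2 / min δ1 δn * ‖b‖ * μ ^ (2 * (j / 2))
      ≤ 2 / min δ1 δn * ‖b‖ * (μ ^ j / μ) := by gcongr
    _ = _ := by ring
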